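/- **Setting.** $\lambda C$-terms are built from variables, application $(t)u$, abstraction $\lambda x\,t$ and a constant $C$; $\simeq_\beta$ is $\beta$-equivalence of $\lambda C$-terms, and $\underline n=\lambda x\lambda f\,(f)^n x$. Write $t\succ_C t'$ if $t'$ is obtained from $t$ by finitely many applications of the rules $(\lambda x\,u)t\,t_1\dots t_k\to(u[t/x])t_1\dots t_k$ and $(C)t\,t_1\dots t_k\to(t)\lambda x(x)t_1\dots t_k$ ($k\ge 0$, $x$ not in $t_1,\dots,t_k$). Types are the formulas of second-order predicate logic built with $\bot$, $\to$, $\forall$ over a language with a constant $0$ and a unary function symbol $s$; besides the ordinary second-order variables $X$ there are, for each arity, countably many *classical variables* $X_C$. Put $\neg A=A\to\bot$. A formula is a *classical type* if it ends with (that is, if the atom reached by passing from $A\to B$ to $B$ and from $\forall v\,A$ to $A$ is formed with) $\bot$ or a classical variable. Let $E$ be a set of equations between individual terms, and let $\approx$ be the least congruence on terms containing all substitution instances of the equations of $E$. Assume that $E$ is adequate with the type of integers: for all terms $a,b$, $s(a)\not\approx 0$, and $s(a)\approx s(b)$ implies $a\approx b$. The system M2 (with respect to $E$) derives judgements $\Gamma\vdash_{M2}t:A$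 by the following rules: variable, $\to$-introduction ($\lambda x\,t$) and $\to$-elimination ($(t)u$); introduction of $\forall x$, $\forall X$, $\forall X_C$ (the variable not free in $\Gamma$) and elimination of these quantifiers, all without changing the term, where $x$ is instantiated by any individual term, $X$ by any formula and $X_C$ only by a classical type; from $\Gamma\vdash t:A[u/x]$ and $u\approx v$ infer $\Gamma\vdash t:A[v/x]$; and $\Gamma\vdash C:\forall X_C\{\neg\neg X_C\to X_C\}$ ($X_C$ of arity $0$). Let $N[x]=\forall X\{X(0),\forall y(X(y)\to X(sy))\to X(x)\}$, and let $N^C[x]$ be the same formula with a classical variable $X_C$ in place of $X$. A *classical integer of value $n$* is a closed $\lambda C$-term $\theta_n$ with $\vdash_{M2}\theta_n:N^C[s^n(0)]$. **Theorem 8.5.** If $\vdash_{M2}T:\forall x\{N^C[x]\to\neg\neg N[x]\}$, then $T$ is a storage operator for classical integers, that is: $T$ is a closed $\lambda C$-term and, for every $n\in\mathbf N$, there is a $\lambda C$-term $\tau_n\simeq_\beta\underline n$ such that for every classical integer $\theta_n$ of value $n$ there is a substitution $\sigma$ such that $(T)\theta_n f\succ_C(f)\sigma(\tau_n)$, where $f$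 is a new variable. -/

import Mathlib

universe u v

namespace MixedLogic

/-! The terms of the lambda-C-calculus, with de Bruijn indices (so that terms are equal exactly
when they are alpha-equivalent). -/

/-- Lambda-C-terms: variables, application `(t)u`, abstraction, and the constant `C`. -/
inductive Tm : Type
  | var (i : ℕ) : Tm
  | app (t u : Tm) : Tm
  | lam (t : Tm) : Tm
  | C : Tm

namespace Tm

/-- The action of a renaming under a binder. -/
def upRen (ρ : ℕ → ℕ) : ℕ → ℕ
  | 0 => 0
  | i + 1 => ρ i + 1

/-- Renaming of the free variables. -/
def rename : (ℕ → ℕ) → Tm → Tm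
  | ρ, var i => var (ρ i)
  | ρ, app t u => app (rename ρ t) (rename ρ u)
  | ρ, lam t => lam (rename (upRen ρ) t)
  | _, C => C

/-- The term `t` seen below one more binder. -/
def shift (t : Tm) : Tm := t.rename Nat.succ

/-- The action of a substitution under a binder. -/
def upSubst (σ : ℕ → Tm) : ℕ → Tm
  | 0 => var 0
  | i + 1 => (σ i).shift

/-- Simultaneous capture-avoiding substitution `σ(t)` for the free variables of `t`. -/
def subst : (ℕ → Tm) → Tm → Tm
  | σ, var i => σ i
  | σ, app t u => app (subst σ t) (subst σ u)
  | σ, lam t => lam (subst (upSubst σ) t)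
  | _, C => C

/-- The substitution sending variable `0` to `v` and lowering all other variables. -/
def instSubst (v : Tm) : ℕ → Tm
  | 0 => v
  | i + 1 => var i

/-- The contractum `u[v/x]` of the beta-redex `(λx u)v`. -/
def inst (u v : Tm) : Tm := u.subst (instSubst v)

/-- All free variables of the term have index below `k`. -/
def ClosedAt : ℕ → Tm → Prop
  | k, var i => i < k
  | k, app t u => ClosedAt k t ∧ ClosedAt k u
  | k, lam t => ClosedAt (k + 1) t
  | _, C => True

/-- Terms without free variables. -/
def Closed (t : Tm) : Prop := t.ClosedAt 0

/-- The term `(t)t₁…tₙ`. -/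
def apps (t : Tm) (ts : List Tm) : Tm := ts.foldl app t

/-- One step of beta-reduction, anywhere in the term. -/
inductive BetaStep : Tm → Tm → Prop
  | beta (u t : Tm) : BetaStep (app (lam u) t) (u.inst t)
  | appL {t t' : Tm} (u : Tm) : BetaStep t t' → BetaStep (app t u) (app t' u)
  | appR (t : Tm) {u u' : Tm} : BetaStep u u' → BetaStep (app t u) (app t u')
  | lam {t t' : Tm} : BetaStep t t' → BetaStep (lam t) (lam t')

/-- Beta-equivalence of lambda-C-terms. -/
def BetaEq : Tm → Tm → Prop := Relation.EqvGen BetaStep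

/-- One step of head C-reduction:
`(λx u)t t₁…tₙ → (u[t/x])t₁…tₙ` and `(C)t t₁…tₙ → (t)λx(x)t₁…tₙ` with `x` not in `t₁,…,tₙ`. -/
inductive HeadStep : Tm → Tm → Prop
  | beta (u t : Tm) (ts : List Tm) :
      HeadStep (apps (app (lam u) t) ts) (apps (u.inst t) ts)
  | control (t : Tm) (ts : List Tm) :
      HeadStep (apps (app C t) ts) (app t (lam (apps (var 0) (ts.map shift))))

/-- Finitely many (possibly zero) steps of head C-reduction. -/
def HeadRed : Tm → Tm → Prop := Relation.ReflTransGen HeadStep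

/-- The Church integer `λx λf (f)ⁿx`. -/
def church (n : ℕ) : Tm := lam (lam ((app (var 0))^[n] (var 1)))

end Tm

/-! Formulas of second-order predicate logic over a first-order language `L`. -/

/-- The two sorts of second-order variables: ordinary variables `X` and classical variables
`X_C`. -/
inductive Kind : Type
  | ordinary : Kind
  | classical : Kind
  deriving DecidableEq

/-- Second-order formulas. Individual variables are de Bruijn indices (the free variables of terms
in `L.Term ℕ`). Second-order variables have a kind and an arity; for each kind `κ` and each
arity `n` there is a separate family of de Bruijn indices, and `all₂ κ n` binds index `0` of that
family only. -/
inductive Formula (L : FirstOrder.Language.{u, v}) : Type (max u v)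
  | bot : Formula L
  | rel {n : ℕ} (R : L.Relations n) (ts : Fin n → L.Term ℕ) : Formula L
  | pvar (κ : Kind) (n i : ℕ) (ts : Fin n → L.Term ℕ) : Formula L
  | imp (A B : Formula L) : Formula L
  | all₁ (A : Formula L) : Formula L
  | all₂ (κ : Kind) (n : ℕ) (A : Formula L) : Formula L

namespace Formula

variable {L : FirstOrder.Language.{u, v}}

/-- The formula `¬A`, that is `A → ⊥`. -/
def neg (A : Formula L) : Formula L := imp A bot

/-- The action of a substitution of individual terms under an individual binder. -/
def upSubst₁ (σ : ℕ → L.Term ℕ) : ℕ → L.Term ℕ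
  | 0 => FirstOrder.Language.Term.var 0
  | i + 1 => (σ i).relabel Nat.succ

/-- Simultaneous substitution of terms for the individual variables. -/
def subst₁ : (ℕ → L.Term ℕ) → Formula L → Formula L
  | _, bot => bot
  | σ, rel R ts => rel R (fun j => (ts j).subst σ)
  | σ, pvar κ n i ts => pvar κ n i (fun j => (ts j).subst σ)
  | σ, imp A B => imp (subst₁ σ A) (subst₁ σ B)
  | σ, all₁ A => all₁ (subst₁ (upSubst₁ σ) A)
  | σ, all₂ κ n A => all₂ κ n (subst₁ σ A)

/-- Renaming of the individual variables. -/
def rename₁ (ρ : ℕ → ℕ) (A : Formula L) : Formula L :=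
  A.subst₁ (fun i => FirstOrder.Language.Term.var (ρ i))

/-- The formula seen below one more individual binder. -/
def shift₁ (A : Formula L) : Formula L := A.rename₁ Nat.succ

/-- The substitution sending individual variable `0` to `a` and lowering the others. -/
def instSubst₁ (a : L.Term ℕ) : ℕ → L.Term ℕ
  | 0 => a
  | i + 1 => FirstOrder.Language.Term.var i

/-- `A[a/x]`, where `x` is the individual variable of index `0`. -/
def inst₁ (A : Formula L) (a : L.Term ℕ) : Formula L := A.subst₁ (instSubst₁ a)

/-- The action of a renaming of second-order variables under the binder `all₂ κ n`. -/
def upRen₂ (κ : Kind) (n : ℕ) (ρ : Kind → ℕ → ℕ → ℕ) : Kind → ℕ → ℕ → ℕ :=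
  fun κ' n' i => if κ' = κ ∧ n' = n then Tm.upRen (ρ κ' n') i else ρ κ' n' i

/-- Renaming of the second-order variables, respecting kinds and arities. -/
def rename₂ : (Kind → ℕ → ℕ → ℕ) → Formula L → Formula L
  | _, bot => bot
  | _, rel R ts => rel R ts
  | ρ, pvar κ n i ts => pvar κ n (ρ κ n i) ts
  | ρ, imp A B => imp (rename₂ ρ A) (rename₂ ρ B)
  | ρ, all₁ A => all₁ (rename₂ ρ A)
  | ρ, all₂ κ n A => all₂ κ n (rename₂ (upRen₂ κ n ρ) A)

/-- The formula seen below one more binder `all₂ κ n`. -/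
def shift₂ (κ : Kind) (n : ℕ) (A : Formula L) : Formula L :=
  A.rename₂ (fun κ' n' i => if κ' = κ ∧ n' = n then i + 1 else i)

/-- The formula `X(x₀,…,xₙ₋₁)`, as a formula with the parameters `x₀,…,xₙ₋₁`. -/
def generic (κ : Kind) (n i : ℕ) : Formula L :=
  pvar κ n i (fun j => FirstOrder.Language.Term.var j)

/-- `G[t₀/x₀,…,tₙ₋₁/xₙ₋₁]` for a formula `G` with `n` parameters: in `G` the individual variables
of index `j < n` are the parameters, and index `n + j` stands for the ambient variable `j`. -/
def applyTo {n : ℕ} (G : Formula L) (ts : Fin n → L.Term ℕ) : Formula L :=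
  G.subst₁ (fun j => if h : j < n then ts ⟨j, h⟩ else FirstOrder.Language.Term.var (j - n))

/-- The action of a second-order substitution under an individual binder: the parameters stay
fixed, the ambient individual variables are shifted. -/
def upSubst₂₁ (σ : Kind → ℕ → ℕ → Formula L) : Kind → ℕ → ℕ → Formula L :=
  fun κ n i => (σ κ n i).rename₁ (fun j => if j < n then j else j + 1)

/-- The action of a second-order substitution under the binder `all₂ κ n`. -/
def upSubst₂₂ (κ : Kind) (n : ℕ) (σ : Kind → ℕ → ℕ → Formula L) : Kind → ℕ → ℕ → Formula L :=
  fun κ' n' i =>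
    if κ' = κ ∧ n' = n then
      match i with
      | 0 => generic κ n 0
      | i + 1 => (σ κ' n' i).shift₂ κ n
    else (σ κ' n' i).shift₂ κ n

/-- Simultaneous substitution for the second-order variables: an atom `X(t₀,…,tₙ₋₁)` becomes
`G[t₀/x₀,…,tₙ₋₁/xₙ₋₁]`, where `G` is the formula with `n` parameters assigned to `X`. -/
def subst₂ : (Kind → ℕ → ℕ → Formula L) → Formula L → Formula L
  | _, bot => bot
  | _, rel R ts => rel R ts
  | σ, pvar κ n i ts => (σ κ n i).applyTo ts
  | σ, imp A B => imp (subst₂ σ A) (subst₂ σ B)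
  | σ, all₁ A => all₁ (subst₂ (upSubst₂₁ σ) A)
  | σ, all₂ κ n A => all₂ κ n (subst₂ (upSubst₂₂ κ n σ) A)

/-- The substitution sending the second-order variable `0` of kind `κ` and arity `n` to `G`,
lowering the other variables of this kind and arity, and fixing all the others. -/
def instSubst₂ (κ : Kind) (n : ℕ) (G : Formula L) : Kind → ℕ → ℕ → Formula L :=
  fun κ' n' i =>
    if κ' = κ ∧ n' = n then
      match i with
      | 0 => G
      | i + 1 => generic κ n i
    else generic κ' n' i

/-- `A[G/X]`, where `X` is the second-order variable of kind `κ`, arity `n` and index `0`, and `G`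
is a formula with `n` parameters. -/
def inst₂ (κ : Kind) (n : ℕ) (A G : Formula L) : Formula L := A.subst₂ (instSubst₂ κ n G)

/-- Classical types: the formulas ending with `⊥` or with a classical variable. -/
def IsClassical : Formula L → Prop
  | bot => True
  | rel _ _ => False
  | pvar κ _ _ _ => κ = Kind.classical
  | imp _ B => IsClassical B
  | all₁ A => IsClassical A
  | all₂ _ _ A => IsClassical A

/-- The translation `A^C` of a formula without classical variables: each ordinary second-order
variable `X`, free or bound, is replaced by the associated classical variable `X_C`. -/
def toC : Formula L → Formula L
  | bot => bot
  | rel R ts => rel R ts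
  | pvar _ n i ts => pvar Kind.classical n i ts
  | imp A B => imp (toC A) (toC B)
  | all₁ A => all₁ (toC A)
  | all₂ _ n A => all₂ Kind.classical n (toC A)

end Formula

/-! Equations between individual terms. -/

/-- The relation `a ≈ b` determined by a set `E` of equations: the least congruence on terms that
contains all the substitution instances of the equations in `E`. -/
inductive TermEq {L : FirstOrder.Language.{u, v}} (E : Set (L.Term ℕ × L.Term ℕ)) :
    L.Term ℕ → L.Term ℕ → Prop
  | ax (a b : L.Term ℕ) (h : (a, b) ∈ E) (σ : ℕ → L.Term ℕ) : TermEq E (a.subst σ) (b.subst σ)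
  | refl (a : L.Term ℕ) : TermEq E a a
  | symm {a b : L.Term ℕ} : TermEq E a b → TermEq E b a
  | trans {a b c : L.Term ℕ} : TermEq E a b → TermEq E b c → TermEq E a c
  | congr {n : ℕ} (g : L.Functions n) (as bs : Fin n → L.Term ℕ) :
      (∀ j, TermEq E (as j) (bs j)) →
        TermEq E (FirstOrder.Language.Term.func g as) (FirstOrder.Language.Term.func g bs)

section Integers

variable {L : FirstOrder.Language.{u, v}}

/-- The term `0`. -/
def zeroTerm (zero : L.Functions 0) : L.Term ℕ :=
  FirstOrder.Language.Term.func zero (fun j => j.elim0)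

/-- The term `s(a)`. -/
def succTerm (succ : L.Functions 1) (a : L.Term ℕ) : L.Term ℕ :=
  FirstOrder.Language.Term.func succ (fun _ => a)

/-- The term `sⁿ(0)`. -/
def numeral (zero : L.Functions 0) (succ : L.Functions 1) (n : ℕ) : L.Term ℕ :=
  (succTerm succ)^[n] (zeroTerm zero)

/-- The set of equations `E` is adequate with the type of integers: `s(a) ≉ 0`, and `s(a) ≈ s(b)`
implies `a ≈ b`. -/
def Adequate (zero : L.Functions 0) (succ : L.Functions 1) (E : Set (L.Term ℕ × L.Term ℕ)) : Prop :=
  (∀ a, ¬ TermEq E (succTerm succ a) (zeroTerm zero)) ∧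
    ∀ a b, TermEq E (succTerm succ a) (succTerm succ b) → TermEq E a b

/-- The type of integers `N[a] = ∀X{X(0), ∀y(X(y) → X(sy)) → X(a)}`. -/
def natType (zero : L.Functions 0) (succ : L.Functions 1) (a : L.Term ℕ) : Formula L :=
  .all₂ .ordinary 1
    (.imp (.pvar .ordinary 1 0 (fun _ => zeroTerm zero))
      (.imp
        (.all₁ (.imp (.pvar .ordinary 1 0 (fun _ => .var 0))
          (.pvar .ordinary 1 0 (fun _ => succTerm succ (.var 0)))))
        (.pvar .ordinary 1 0 (fun _ => a))))

end Integers

/-- The type system M2 with respect to a set `E` of equations: `Typing E Γ t A` means that the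
lambda-C-term `t` is of type `A` in the context `Γ`, where variable `i` has the `i`-th type of
`Γ`. -/
inductive Typing {L : FirstOrder.Language.{u, v}} (E : Set (L.Term ℕ × L.Term ℕ)) :
    List (Formula L) → Tm → Formula L → Prop
  | var {Γ : List (Formula L)} {i : ℕ} {A : Formula L} :
      Γ[i]? = some A → Typing E Γ (Tm.var i) A
  | lam {Γ : List (Formula L)} {t : Tm} {A B : Formula L} :
      Typing E (A :: Γ) t B → Typing E Γ (Tm.lam t) (.imp A B)
  | app {Γ : List (Formula L)} {t w : Tm} {A B : Formula L} :
      Typing E Γ t (.imp A B) → Typing E Γ w A → Typing E Γ (Tm.app t w) B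
  | gen₁ {Γ : List (Formula L)} {t : Tm} {A : Formula L} :
      Typing E (Γ.map Formula.shift₁) t A → Typing E Γ t (.all₁ A)
  | spec₁ {Γ : List (Formula L)} {t : Tm} {A : Formula L} (a : L.Term ℕ) :
      Typing E Γ t (.all₁ A) → Typing E Γ t (A.inst₁ a)
  | gen₂ {Γ : List (Formula L)} {t : Tm} {A : Formula L} (κ : Kind) (n : ℕ) :
      Typing E (Γ.map (Formula.shift₂ κ n)) t A → Typing E Γ t (.all₂ κ n A)
  /- Ordinary second-order variables are instantiated by arbitrary formulas. -/
  | spec₂ {Γ : List (Formula L)} {t : Tm} {n : ℕ} {A : Formula L} (G : Formula L) :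
      Typing E Γ t (.all₂ .ordinary n A) → Typing E Γ t (A.inst₂ .ordinary n G)
  /- Classical second-order variables are instantiated by classical types only. -/
  | spec₂C {Γ : List (Formula L)} {t : Tm} {n : ℕ} {A : Formula L} (G : Formula L) :
      G.IsClassical → Typing E Γ t (.all₂ .classical n A) → Typing E Γ t (A.inst₂ .classical n G)
  | eqn {Γ : List (Formula L)} {t : Tm} {A : Formula L} {a b : L.Term ℕ} :
      TermEq E a b → Typing E Γ t (A.inst₁ a) → Typing E Γ t (A.inst₁ b)
  /- The constant `C` has type `∀X_C(¬¬X_C → X_C)`. -/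
  | control {Γ : List (Formula L)} :
      Typing E Γ Tm.C
        (.all₂ .classical 0
          (.imp (Formula.neg (Formula.neg (Formula.generic .classical 0 0)))
            (Formula.generic .classical 0 0)))

section Storage

variable {L : FirstOrder.Language.{u, v}}

/-- The term `θ` is a classical integer of value `n`: it is closed and of type `N^C[sⁿ(0)]`. -/
def IsClassicalInteger (zero : L.Functions 0) (succ : L.Functions 1)
    (E : Set (L.Term ℕ × L.Term ℕ)) (n : ℕ) (θ : Tm) : Prop :=
  θ.Closed ∧ Typing E [] θ (natType zero succ (numeral zero succ n)).toC

/-- The term `T` is a storage operator for classical integers. Since `T` and `θ` are closed, every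
variable `f` is new. -/
def IsStorageOperator (zero : L.Functions 0) (succ : L.Functions 1)
    (E : Set (L.Term ℕ × L.Term ℕ)) (T : Tm) : Prop :=
  T.Closed ∧
    ∀ n : ℕ, ∃ τ : Tm, Tm.BetaEq τ (Tm.church n) ∧
      ∀ θ : Tm, IsClassicalInteger zero succ E n θ →
        ∀ f : ℕ, ∃ σ : ℕ → Tm,
          Tm.HeadRed (.app (.app T θ) (.var f)) (.app (.var f) (τ.subst σ))

/-- The type `∀x{N^C[x] → ¬¬N[x]}`. -/
def storageType (zero : L.Functions 0) (succ : L.Functions 1) : Formula L :=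
  .all₁ (.imp (natType zero succ (.var 0)).toC (natType zero succ (.var 0)).neg.neg)

end Storage

end MixedLogic

/-!
The proof is by Kripke realizability over a machine that runs `T` on an *unknown* integer.

The machine reduces `(T)ν f`, where `ν` is a variable standing for the unknown integer of value `n`.
When `ν` comes to the head with arguments `r`, `s` and a stack `π`, the machine behaves as an
integer would: it goes on with `(s)x π` for a new unknown `x` of level `n - 1`, and when `x` is
called on a stack `π'` it goes on with `(s)x' π'` for a new unknown `x'` of level `n - 2`, until
level `0`, where `r` is called. The machine is deterministic (`Reach.final_unique`) and does not
know `θ`. If it stops at `(f)τ`, then `τ` depends on `T` and `n` only.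

A classical integer `θ` may behave differently: it may discard the stack on which it has just been
called, and come back to an earlier one. It does however come back to a stack that the machine has
met, up to the values of the unknowns, and reaching the result from there is as good. The notion of
realizability expresses this. A world (`World`) lists the unknowns introduced so far, each with the
term for which it stands when `ν` is replaced by `θ`. The pole (`runPole`) contains the terms `p`
such that, if the machine ever meets `p`, then the value of `p` head reduces to an instance of
`(f)τ`. Formulas are interpreted by families of sets of terms indexed by the worlds (`realizers`);
classical variables range over biorthogonals with respect to the pole, which makes `C` sound, while
ordinary variables range over all the families closed under weak head beta-expansion. Every typed
term realizes its type (`Typing.subst_mem_realizers`).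

Three facts are then needed. First, `ν` realizes `N^C[sⁿ(0)]` (`unknown_mem_realizers`). This
follows from the adequacy of `θ` in a second model, with only one world, where `X_C(sᵏ(0))` is
interpreted by the terms that yield the result on all the stacks on which the machine calls unknowns of level `k`.
Secondly, a realizer of `N[sⁿ(0)]` is beta-equivalent to the Church integer
(`betaEq_church_of_mem_realizers`), because an ordinary `X` may be interpreted by the terms
beta-equivalent to `(g)ᵏx`, with fresh `x` and `g`, that weakly head reduce to `x` or to some `(g)p`;
hence `f` realizes `¬N[sⁿ(0)]`. Thirdly, `T`
realizes its type, so that `(T)ν f` is in the pole. The individuals are the terms modulo the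
equations of `E`; adequacy of `E` makes their numerals distinct.
-/

namespace MixedLogic

namespace Tm

/-! ### Renaming and substitution -/

theorem rename_rename (t : Tm) (ρ ρ' : ℕ → ℕ) :
    (t.rename ρ).rename ρ' = t.rename (fun i => ρ' (ρ i)) := by
  induction t generalizing ρ ρ' with
  | var i => rfl
  | C => rfl
  | app t u iht ihu => simp only [rename, iht, ihu]
  | lam t ih =>
    simp only [rename, ih]
    congr 2
    funext i
    cases i <;> rfl

theorem subst_rename (t : Tm) (ρ : ℕ → ℕ) (σ : ℕ → Tm) :
    (t.rename ρ).subst σ = t.subst (fun i => σ (ρ i)) := by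
  induction t generalizing ρ σ with
  | var i => rfl
  | C => rfl
  | app t u iht ihu => simp only [rename, subst, iht, ihu]
  | lam t ih =>
    simp only [rename, subst, ih]
    congr 2
    funext i
    cases i <;> rfl

theorem rename_subst (t : Tm) (σ : ℕ → Tm) (ρ : ℕ → ℕ) :
    (t.subst σ).rename ρ = t.subst (fun i => (σ i).rename ρ) := by
  induction t generalizing ρ σ with
  | var i => rfl
  | C => rfl
  | app t u iht ihu => simp only [rename, subst, iht, ihu]
  | lam t ih =>
    simp only [rename, subst, ih]
    congr 2
    funext i
    cases i with
    | zero => rfl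
    | succ i => simp only [upSubst, shift, rename_rename]; rfl

theorem shift_subst (t : Tm) (σ : ℕ → Tm) : t.shift.subst (upSubst σ) = (t.subst σ).shift := by
  simp only [shift, subst_rename, rename_subst]; rfl

theorem subst_subst (t : Tm) (σ τ : ℕ → Tm) :
    (t.subst σ).subst τ = t.subst (fun i => (σ i).subst τ) := by
  induction t generalizing σ τ with
  | var i => rfl
  | C => rfl
  | app t u iht ihu => simp only [subst, iht, ihu]
  | lam t ih =>
    simp only [subst, ih]
    congr 2
    funext i
    cases i with
    | zero => rfl
    | succ i => simp only [upSubst, shift_subst]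

theorem upSubst_var : upSubst var = var := by
  funext i
  cases i <;> rfl

theorem subst_var (t : Tm) : t.subst var = t := by
  induction t with
  | var i => rfl
  | C => rfl
  | app t u iht ihu => simp only [subst, iht, ihu]
  | lam t ih => simp only [subst, upSubst_var, ih]

theorem shift_inst (t v : Tm) : t.shift.inst v = t := by
  simp only [shift, inst, subst_rename]
  exact subst_var t

/-- The substitution `σ` extended by `v` at index `0`. -/
def cons (v : Tm) (σ : ℕ → Tm) : ℕ → Tm
  | 0 => v
  | i + 1 => σ i

theorem subst_upSubst_inst (t v : Tm) (σ : ℕ → Tm) :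
    (t.subst (upSubst σ)).inst v = t.subst (cons v σ) := by
  simp only [inst, subst_subst]
  congr 1
  funext i
  cases i with
  | zero => rfl
  | succ i => exact shift_inst (σ i) v

theorem inst_subst (u t : Tm) (σ : ℕ → Tm) :
    (u.inst t).subst σ = (u.subst (upSubst σ)).inst (t.subst σ) := by
  rw [subst_upSubst_inst]
  simp only [inst, subst_subst]
  congr 1
  funext i
  cases i <;> rfl

/-! ### Free variables -/

theorem ClosedAt.mono {t : Tm} {k m : ℕ} (h : t.ClosedAt k) (hkm : k ≤ m) : t.ClosedAt m := by
  induction t generalizing k m with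
  | var i => exact lt_of_lt_of_le h hkm
  | C => trivial
  | app t u iht ihu => exact ⟨iht h.1 hkm, ihu h.2 hkm⟩
  | lam t ih => exact ih (k := k + 1) (m := m + 1) h (by omega)

theorem exists_closedAt (t : Tm) : ∃ k, t.ClosedAt k := by
  induction t with
  | var i => exact ⟨i + 1, Nat.lt_succ_self i⟩
  | C => exact ⟨0, trivial⟩
  | app t u iht ihu =>
    obtain ⟨k, hk⟩ := iht
    obtain ⟨m, hm⟩ := ihu
    exact ⟨max k m, hk.mono (le_max_left _ _), hm.mono (le_max_right _ _)⟩
  | lam t ih =>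
    obtain ⟨k, hk⟩ := ih
    exact ⟨k, hk.mono (Nat.le_succ k)⟩

theorem ClosedAt.subst_congr {t : Tm} {k : ℕ} (h : t.ClosedAt k) {σ τ : ℕ → Tm}
    (hστ : ∀ i < k, σ i = τ i) : t.subst σ = t.subst τ := by
  induction t generalizing k σ τ with
  | var i => exact hστ i h
  | C => rfl
  | app t u iht ihu => simp only [subst, iht h.1 hστ, ihu h.2 hστ]
  | lam t ih =>
    simp only [subst]
    congr 1
    refine ih (k := k + 1) h fun i hi => ?_
    cases i with
    | zero => rfl
    | succ i => simp only [upSubst, hστ i (by omega)]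

theorem Closed.subst_eq {t : Tm} (h : t.Closed) (σ : ℕ → Tm) : t.subst σ = t := by
  rw [h.subst_congr (τ := var) (by simp), subst_var]

theorem ClosedAt.rename {t : Tm} {k m : ℕ} (h : t.ClosedAt k) {ρ : ℕ → ℕ}
    (hρ : ∀ i < k, ρ i < m) : (t.rename ρ).ClosedAt m := by
  induction t generalizing k m ρ with
  | var i => exact hρ i h
  | C => trivial
  | app t u iht ihu => exact ⟨iht h.1 hρ, ihu h.2 hρ⟩
  | lam t ih =>
    refine ih (k := k + 1) (m := m + 1) h fun i hi => ?_
    cases i with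
    | zero => exact Nat.succ_pos m
    | succ i => exact Nat.succ_lt_succ (hρ i (by omega))

theorem ClosedAt.shift {t : Tm} {k : ℕ} (h : t.ClosedAt k) : t.shift.ClosedAt (k + 1) :=
  h.rename fun _ hi => Nat.succ_lt_succ hi

theorem ClosedAt.subst {t : Tm} {k m : ℕ} (h : t.ClosedAt k) {σ : ℕ → Tm}
    (hσ : ∀ i < k, (σ i).ClosedAt m) : (t.subst σ).ClosedAt m := by
  induction t generalizing k m σ with
  | var i => exact hσ i h
  | C => trivial
  | app t u iht ihu => exact ⟨iht h.1 hσ, ihu h.2 hσ⟩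
  | lam t ih =>
    refine ih (k := k + 1) (m := m + 1) h fun i hi => ?_
    cases i with
    | zero => exact Nat.succ_pos m
    | succ i => exact (hσ i (by omega)).shift

theorem ClosedAt.inst {u t : Tm} {k : ℕ} (hu : u.ClosedAt (k + 1)) (ht : t.ClosedAt k) :
    (u.inst t).ClosedAt k := by
  refine ClosedAt.subst hu fun i hi => ?_
  cases i with
  | zero => exact ht
  | succ i => exact Nat.lt_of_succ_lt_succ hi

/-! ### Head and arguments -/

theorem apps_append (t : Tm) (ts ts' : List Tm) : t.apps (ts ++ ts') = (t.apps ts).apps ts' :=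
  List.foldl_append

theorem apps_concat (t : Tm) (ts : List Tm) (u : Tm) : t.apps (ts ++ [u]) = app (t.apps ts) u := by
  rw [apps_append]; rfl

theorem subst_apps (t : Tm) (ts : List Tm) (σ : ℕ → Tm) :
    (t.apps ts).subst σ = (t.subst σ).apps (ts.map (subst σ)) := by
  induction ts generalizing t with
  | nil => rfl
  | cons u ts ih => exact ih (app t u)

theorem subst_iterate_app (t u : Tm) (n : ℕ) (σ : ℕ → Tm) :
    ((app t)^[n] u).subst σ = (app (t.subst σ))^[n] (u.subst σ) := by
  induction n with
  | zero => rfl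
  | succ n ih => simp only [Function.iterate_succ_apply', subst, ih]

theorem closedAt_apps {t : Tm} {ts : List Tm} {k : ℕ} :
    (t.apps ts).ClosedAt k ↔ t.ClosedAt k ∧ ∀ u ∈ ts, u.ClosedAt k := by
  induction ts generalizing t with
  | nil => simp [apps]
  | cons u ts ih =>
    have h := ih (t := app t u)
    simp only [apps, List.foldl_cons, ClosedAt, List.forall_mem_cons] at h ⊢
    rw [h, and_assoc]

/-- The head of a term: what remains after stripping all its arguments. -/
def head : Tm → Tm
  | app t _ => head t
  | var i => var i
  | lam t => lam t
  | C => C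

/-- The list of arguments to which the head of a term is applied. -/
def args : Tm → List Tm
  | app t u => args t ++ [u]
  | _ => []

@[simp] theorem head_apps (t : Tm) (ts : List Tm) : (t.apps ts).head = t.head := by
  induction ts generalizing t with
  | nil => rfl
  | cons u ts ih => exact ih (app t u)

@[simp] theorem args_apps (t : Tm) (ts : List Tm) : (t.apps ts).args = t.args ++ ts := by
  induction ts generalizing t with
  | nil => simp [apps]
  | cons u ts ih =>
    change ((app t u).apps ts).args = _
    rw [ih]
    simp [args]

theorem head_apps_args (t : Tm) : t.head.apps t.args = t := by
  induction t with
  | app t u iht _ => rw [head, args, apps_concat, iht]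
  | _ => rfl

/-! ### Reduction -/

theorem HeadStep.subst {p q : Tm} (h : HeadStep p q) (σ : ℕ → Tm) :
    HeadStep (p.subst σ) (q.subst σ) := by
  cases h with
  | beta u t ts =>
    simp only [subst_apps, inst_subst]
    exact .beta _ _ _
  | control t ts =>
    have h : (lam (apps (var 0) (ts.map shift))).subst σ =
        lam (apps (var 0) ((ts.map (Tm.subst σ)).map shift)) := by
      simp [Tm.subst, subst_apps, upSubst, Function.comp_def, shift_subst]
    simp only [subst_apps, Tm.subst] at h ⊢
    rw [h]
    exact .control _ _

theorem apps_shift_inst (s : Tm) (ts : List Tm) :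
    (apps (var 0) (ts.map shift)).inst s = s.apps ts := by
  simp only [inst, subst_apps, List.map_map, Function.comp_def]
  have h : ∀ t : Tm, t.shift.subst (instSubst s) = t := fun t => shift_inst t s
  simp [h, Tm.subst, instSubst]

/-- One step of weak head beta-reduction: the beta part of `HeadStep`. -/
inductive WeakHeadStep : Tm → Tm → Prop
  | beta (u t : Tm) (ts : List Tm) :
      WeakHeadStep (apps (app (lam u) t) ts) (apps (u.inst t) ts)

theorem WeakHeadStep.headStep {p q : Tm} (h : WeakHeadStep p q) : HeadStep p q := by
  cases h with
  | beta u t ts => exact .beta u t ts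

theorem WeakHeadStep.apps {p q : Tm} (h : WeakHeadStep p q) (ts : List Tm) :
    WeakHeadStep (p.apps ts) (q.apps ts) := by
  cases h with
  | beta u t ts' =>
    rw [← apps_append, ← apps_append]
    exact .beta _ _ _

theorem BetaStep.apps {p q : Tm} (h : BetaStep p q) (ts : List Tm) :
    BetaStep (p.apps ts) (q.apps ts) := by
  induction ts generalizing p q with
  | nil => exact h
  | cons u ts ih => exact ih (h.appL u)

theorem WeakHeadStep.betaStep {p q : Tm} (h : WeakHeadStep p q) : BetaStep p q := by
  cases h with
  | beta u t ts => exact (BetaStep.beta u t).apps ts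

theorem WeakHeadStep.closedAt {p q : Tm} (h : WeakHeadStep p q) {k : ℕ} (hp : p.ClosedAt k) :
    q.ClosedAt k := by
  cases h with
  | beta u t ts =>
    rw [closedAt_apps] at hp ⊢
    exact ⟨ClosedAt.inst hp.1.1 hp.1.2, hp.2⟩

theorem WeakHeadStep.eq_of_lam {u t q : Tm} {ts : List Tm}
    (h : WeakHeadStep ((lam u).apps (t :: ts)) q) : q = (u.inst t).apps ts := by
  generalize hp : (lam u).apps (t :: ts) = p at h
  cases h with
  | beta u' t' ts' =>
    have h₁ := congrArg head hp
    have h₂ := congrArg args hp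
    simp only [head_apps, args_apps, head, args, List.nil_append, List.singleton_append,
      List.cons.injEq, lam.injEq] at h₁ h₂
    rw [h₁, h₂.1, h₂.2]

theorem BetaStep.subst {p q : Tm} (h : BetaStep p q) (σ : ℕ → Tm) :
    BetaStep (p.subst σ) (q.subst σ) := by
  induction h generalizing σ with
  | beta u t =>
    rw [inst_subst]
    exact .beta _ _
  | appL u _ ih => exact .appL _ (ih σ)
  | appR t _ ih => exact .appR _ (ih σ)
  | lam _ ih => exact .lam (ih _)

theorem BetaEq.map {g : Tm → Tm} (hg : ∀ p q, BetaStep p q → BetaStep (g p) (g q)) {p q : Tm}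
    (h : BetaEq p q) : BetaEq (g p) (g q) := by
  induction h with
  | rel _ _ h => exact .rel _ _ (hg _ _ h)
  | refl _ => exact .refl _
  | symm _ _ _ ih => exact .symm _ _ ih
  | trans _ _ _ _ _ ih₁ ih₂ => exact .trans _ _ _ ih₁ ih₂

theorem betaEq_of_weakHead {p q : Tm} (h : Relation.ReflTransGen WeakHeadStep p q) :
    BetaEq p q := by
  induction h with
  | refl => exact .refl _
  | tail _ h ih => exact .trans _ _ _ ih (.rel _ _ h.betaStep)

theorem closedAt_of_weakHead {p q : Tm} (h : Relation.ReflTransGen WeakHeadStep p q) {k : ℕ}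
    (hp : p.ClosedAt k) : q.ClosedAt k := by
  induction h with
  | refl => exact hp
  | tail _ h ih => exact h.closedAt ih

/-- The weak head reduction of `(t)t₁…tₙ` first reduces `t`, either to the end or until `t` becomes
an abstraction. -/
theorem weakHead_apps_cases {t q : Tm} {ts : List Tm}
    (h : Relation.ReflTransGen WeakHeadStep (t.apps ts) q) :
    (∃ t', Relation.ReflTransGen WeakHeadStep t t' ∧ q = t'.apps ts) ∨
    ∃ u, Relation.ReflTransGen WeakHeadStep t (lam u) ∧
      Relation.ReflTransGen WeakHeadStep ((lam u).apps ts) q := by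
  generalize hp : t.apps ts = p at h
  induction h using Relation.ReflTransGen.head_induction_on generalizing t with
  | refl => exact .inl ⟨t, .refl, hp.symm⟩
  | @head p p' hpp' hrest ih =>
    cases hpp' with
    | beta u s rs =>
      have h₁ := congrArg head hp
      have h₂ := congrArg args hp
      simp only [head_apps, args_apps, head, args, List.nil_append, List.singleton_append]
        at h₁ h₂
      have ht := head_apps_args t
      rw [h₁] at ht
      cases has : t.args with
      | nil =>
        rw [has] at ht
        refine .inr ⟨u, ?_, ?_⟩
        · rw [← ht]; exact .refl
        · have : (lam u).apps ts = apps (app (lam u) s) rs := by rw [← hp, ← ht]; rfl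
          rw [this]
          exact .head (.beta _ _ _) hrest
      | cons s' as =>
        rw [has, List.cons_append, List.cons.injEq] at h₂
        rw [has, h₂.1] at ht
        have hstep : WeakHeadStep t ((u.inst s).apps as) := by
          rw [← ht]; exact .beta _ _ _
        rcases ih (t := (u.inst s).apps as) (by rw [← apps_append, h₂.2]) with
          ⟨t', h, hq⟩ | ⟨u', h, hq⟩
        · exact .inl ⟨t', .head hstep h, hq⟩
        · exact .inr ⟨u', .head hstep h, hq⟩

/-- If `t` has no free variable of index `m` or more and `(t)x g` has weak head normal form `x` or
`(g)s` for the fresh variables `x` of index `m` and `g` of index `m + 1`, then the beta-equivalence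
`(t)x g ≃ (g)ⁿx` can be abstracted over `x` and `g`. No confluence is needed: the weak head
reduction of `(t)x g` has to turn `t` into two successive abstractions. -/
theorem betaEq_church_of_fresh {t q : Tm} {m n : ℕ} (ht : t.ClosedAt m)
    (hred : Relation.ReflTransGen WeakHeadStep (t.apps [var m, var (m + 1)]) q)
    (hq : q = var m ∨ ∃ s, q = app (var (m + 1)) s)
    (heq : BetaEq (t.apps [var m, var (m + 1)]) ((app (var (m + 1)))^[n] (var m))) :
    BetaEq t (church n) := by
  rcases weakHead_apps_cases hred with ⟨t', ht', rfl⟩ | ⟨u, htu, hu⟩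
  · exfalso
    rcases hq with hq | ⟨s, hq⟩
    · simp [apps] at hq
    · simp [apps] at hq
  rcases Relation.ReflTransGen.cases_head hu with rfl | ⟨r, hr, hrq⟩
  · exfalso
    rcases hq with hq | ⟨s, hq⟩ <;> simp [apps] at hq
  obtain rfl := hr.eq_of_lam
  have hcu : u.ClosedAt (m + 1) := closedAt_of_weakHead htu ht
  have hci : (u.inst (var m)).ClosedAt (m + 1) :=
    ClosedAt.inst (ClosedAt.mono hcu (Nat.le_succ _)) (Nat.lt_succ_self m)
  rcases weakHead_apps_cases hrq with ⟨t', ht', rfl⟩ | ⟨u₂, hu₂, _⟩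
  · exfalso
    rcases hq with hq | ⟨s, hq⟩
    · simp [apps] at hq
    · simp only [apps, List.foldl_cons, List.foldl_nil, app.injEq] at hq
      have := closedAt_of_weakHead ht' hci
      rw [hq.1] at this
      exact absurd this (Nat.lt_irrefl _)
  have hcu₂ : u₂.ClosedAt (m + 2) := closedAt_of_weakHead hu₂ hci
  have e₁ : BetaEq t (lam u) := betaEq_of_weakHead htu
  have e₂ : BetaEq (u.inst (var m)) (lam u₂) := betaEq_of_weakHead hu₂
  have e₃ : BetaEq (t.apps [var m, var (m + 1)]) (u₂.inst (var (m + 1))) := by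
    refine .trans _ _ _ (e₁.map (g := fun t => t.apps _) fun p q h => h.apps _) ?_
    refine .trans _ _ _ (.rel _ _ (.appL _ (.beta _ _))) ?_
    refine .trans _ _ _ (e₂.map (g := fun t => app t _) fun p q h => h.appL _) ?_
    exact .rel _ _ (.beta _ _)
  have e₄ : BetaEq (u₂.inst (var (m + 1))) ((app (var (m + 1)))^[n] (var m)) :=
    .trans _ _ _ (.symm _ _ e₃) heq
  -- `ρ₁` and `ρ₂` turn the fresh variables back into the bound variables `0` and `1`.
  let ρ₁ : ℕ → Tm := fun i => if i = m then var 0 else var (i + 1)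
  let ρ₂ : ℕ → Tm := fun i => if i = m + 1 then var 0 else if i = m then var 1 else var (i + 2)
  have f₁ : (u.inst (var m)).subst ρ₁ = u := by
    rw [inst, subst_subst]
    conv_rhs => rw [← subst_var u]
    refine ClosedAt.subst_congr hcu fun i hi => ?_
    cases i with
    | zero => simp [instSubst, Tm.subst, ρ₁]
    | succ i =>
      have : i ≠ m := by omega
      simp [instSubst, Tm.subst, ρ₁, this]
  have f₂ : u₂.subst (upSubst ρ₁) = (u₂.inst (var (m + 1))).subst ρ₂ := by
    rw [inst, subst_subst]
    refine ClosedAt.subst_congr hcu₂ fun i hi => ?_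
    cases i with
    | zero => simp [upSubst, instSubst, Tm.subst, ρ₂]
    | succ i =>
      have h' : i ≠ m + 1 := by omega
      by_cases h : i = m
      · simp [upSubst, instSubst, Tm.subst, ρ₁, ρ₂, h, shift, rename]
      · simp [upSubst, instSubst, Tm.subst, ρ₁, ρ₂, h, h', shift, rename]
  have f₃ : ((app (var (m + 1)))^[n] (var m)).subst ρ₂ = (app (var 0))^[n] (var 1) := by
    simp [subst_iterate_app, Tm.subst, ρ₂]
  refine .trans _ _ _ e₁ (BetaEq.map (g := lam) (fun _ _ h => h.lam) ?_)
  have e₅ := e₂.map (g := Tm.subst ρ₁) fun _ _ h => h.subst ρ₁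
  rw [f₁] at e₅
  refine .trans _ _ _ e₅ ?_
  rw [Tm.subst, f₂]
  refine BetaEq.map (g := lam) (fun _ _ h => h.lam) ?_
  rw [← f₃]
  exact e₄.map (g := Tm.subst ρ₂) fun _ _ h => h.subst ρ₂

end Tm

/-! ### Kripke realizability -/

section Realizability

variable {L : FirstOrder.Language.{u, v}} {W : Type*} [Preorder W] {M : Type*} [L.Structure M]

/-- The stacks that send every element of `S`, now or in a later world, into the pole `P`. -/
def orth (P S : W → Set Tm) (w : W) : Set (List Tm) :=
  {π | ∀ w', w ≤ w' → ∀ s ∈ S w', s.apps π ∈ P w'}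

/-- The families of sets of terms that may interpret a formula: they grow along the order of the
worlds and are closed under weak head expansion, for the beta rule only. -/
structure IsCandidate (S : W → Set Tm) : Prop where
  mono : ∀ {w w' t}, w ≤ w' → t ∈ S w → t ∈ S w'
  expand : ∀ {w p q}, Tm.WeakHeadStep p q → q ∈ S w → p ∈ S w

/-- The families of sets of terms that may interpret a classical type: those that contain the
biorthogonal with respect to the pole. -/
def IsBiorthogonal (P S : W → Set Tm) : Prop :=
  ∀ w t, (∀ w', w ≤ w' → ∀ π ∈ orth P S w', t.apps π ∈ P w') → t ∈ S w

/-- The possible values of a second-order variable of a given kind. -/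
def IsValue (P : W → Set Tm) (κ : Kind) (S : W → Set Tm) : Prop :=
  IsCandidate S ∧ (κ = .classical → IsBiorthogonal P S)

/-- A pole is closed under the expansions of head C-reduction. -/
structure IsPole (P : W → Set Tm) : Prop where
  expand : ∀ {w p q}, Tm.WeakHeadStep p q → q ∈ P w → p ∈ P w
  control : ∀ {w t π}, .app t (.lam (Tm.apps (.var 0) (π.map Tm.shift))) ∈ P w →
    Tm.apps (.app .C t) π ∈ P w

/-- The environment `ρ` extended by the individual `a` at index `0`. -/
def push₁ (a : M) (ρ : ℕ → M) : ℕ → M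
  | 0 => a
  | i + 1 => ρ i

/-- The values of second-order variables. -/
abbrev Env₂ (W M : Type*) := Kind → ∀ n : ℕ, ℕ → (Fin n → M) → W → Set Tm

/-- The environment `η` extended by `S` at index `0` of the family of kind `κ` and arity `n`. The
value `S` is given for all arities at once, which avoids casts; only its component of arity `n` is
used. -/
def push₂ (κ : Kind) (n : ℕ) (S : ∀ n : ℕ, (Fin n → M) → W → Set Tm) (η : Env₂ W M) : Env₂ W M :=
  fun κ' n' i =>
    if κ' = κ ∧ n' = n then
      match i with
      | 0 => S n'
      | i + 1 => η κ' n' i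
    else η κ' n' i

/-- The individuals assigned to the free variables of a formula with `n` parameters, when the
parameters are `l` and the ambient variables are given by `ρ`. -/
def paramEnv {n : ℕ} (l : Fin n → M) (ρ : ℕ → M) : ℕ → M :=
  fun j => if h : j < n then l ⟨j, h⟩ else ρ (j - n)

/-- The set of realizers of a formula in each world. The relation symbols play no role and are
realized by all terms. -/
def realizers (P : W → Set Tm) : Formula L → (ℕ → M) → Env₂ W M → W → Set Tm
  | .bot, _, _, w => {t | ∀ w', w ≤ w' → t ∈ P w'}
  | .rel _ _, _, _, _ => Set.univ
  | .pvar κ n i ts, ρ, η, w => η κ n i (fun j => (ts j).realize ρ) w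
  | .imp A B, ρ, η, w =>
      {t | ∀ w', w ≤ w' → ∀ s ∈ realizers P A ρ η w', .app t s ∈ realizers P B ρ η w'}
  | .all₁ A, ρ, η, w => {t | ∀ a, t ∈ realizers P A (push₁ a ρ) η w}
  | .all₂ κ n A, ρ, η, w =>
      {t | ∀ S : ∀ n : ℕ, (Fin n → M) → W → Set Tm, (∀ n' l, IsValue P κ (S n' l)) →
        t ∈ realizers P A ρ (push₂ κ n S η) w}

/-- Every variable has an admissible value for its kind. -/
def IsEnv (P : W → Set Tm) (η : Env₂ W M) : Prop := ∀ κ n i l, IsValue P κ (η κ n i l)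

variable {P : W → Set Tm}

theorem IsEnv.push₂ {η : Env₂ W M} (hη : IsEnv P η) {κ : Kind} (n : ℕ)
    {S : ∀ n : ℕ, (Fin n → M) → W → Set Tm} (hS : ∀ n' l, IsValue P κ (S n' l)) :
    IsEnv P (push₂ κ n S η) := by
  intro κ' n' i l
  unfold MixedLogic.push₂
  split_ifs with h
  · obtain ⟨rfl, rfl⟩ := h
    cases i with
    | zero => exact hS _ _
    | succ i => exact hη _ _ _ _
  · exact hη _ _ _ _

theorem isCandidate_realizers (hP : IsPole P) (A : Formula L) (ρ : ℕ → M) {η : Env₂ W M}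
    (hη : IsEnv P η) : IsCandidate (realizers P A ρ η) := by
  induction A generalizing ρ η with
  | bot => exact ⟨fun h ht w' h' => ht w' (h.trans h'), fun h hq w' h' => hP.expand h (hq w' h')⟩
  | rel R ts => exact ⟨fun _ _ => trivial, fun _ _ => trivial⟩
  | pvar κ n i ts => exact (hη κ n i _).1
  | imp A B _ ihB =>
    exact ⟨fun h ht w' h' => ht w' (h.trans h'),
      fun h hq w' h' s hs => (ihB ρ hη).expand (h.apps [s]) (hq w' h' s hs)⟩
  | all₁ A ih =>
    exact ⟨fun h ht a => (ih _ hη).mono h (ht a), fun h hq a => (ih _ hη).expand h (hq a)⟩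
  | all₂ κ n A ih =>
    exact ⟨fun h ht S hS => (ih _ (hη.push₂ n hS)).mono h (ht S hS),
      fun h hq S hS => (ih _ (hη.push₂ n hS)).expand h (hq S hS)⟩

theorem isBiorthogonal_realizers (hP : IsPole P) {A : Formula L} (hA : A.IsClassical) (ρ : ℕ → M)
    {η : Env₂ W M} (hη : IsEnv P η) : IsBiorthogonal P (realizers P A ρ η) := by
  induction A generalizing ρ η with
  | bot => exact fun w t ht w' h => ht w' h [] fun w'' h' s hs => hs w'' le_rfl
  | rel R ts => exact hA.elim
  | pvar κ n i ts => exact (hη κ n i _).2 hA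
  | imp A B _ ihB =>
    intro w t ht w' h s hs
    refine ihB hA ρ hη w' _ fun w'' h' π hπ => ht w'' (h.trans h') (s :: π) ?_
    intro w₃ h₃ r hr
    exact hπ w₃ h₃ _ (hr w₃ le_rfl s ((isCandidate_realizers hP A ρ hη).mono (h'.trans h₃) hs))
  | all₁ A ih =>
    intro w t ht a
    exact ih hA _ hη w t fun w' h π hπ => ht w' h π fun w'' h' s hs => hπ w'' h' s (hs a)
  | all₂ κ n A ih =>
    intro w t ht S hS
    exact ih hA _ (hη.push₂ n hS) w t fun w' h π hπ =>
      ht w' h π fun w'' h' s hs => hπ w'' h' s (hs S hS)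

theorem isValue_realizers (hP : IsPole P) {κ : Kind} {A : Formula L}
    (hA : κ = .classical → A.IsClassical) (ρ : ℕ → M) {η : Env₂ W M} (hη : IsEnv P η) :
    IsValue P κ (realizers P A ρ η) :=
  ⟨isCandidate_realizers hP A ρ hη, fun h => isBiorthogonal_realizers hP (hA h) ρ hη⟩

theorem realizers_subst₁ (A : Formula L) (σ : ℕ → L.Term ℕ) (ρ : ℕ → M) (η : Env₂ W M) :
    realizers P (A.subst₁ σ) ρ η = realizers P A (fun i => (σ i).realize ρ) η := by
  induction A generalizing σ ρ η with
  | bot => rfl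
  | rel R ts => rfl
  | pvar κ n i ts =>
    funext w
    simp only [Formula.subst₁, realizers, FirstOrder.Language.Term.realize_subst]
  | imp A B ihA ihB =>
    funext w
    simp only [Formula.subst₁, realizers, ihA, ihB]
  | all₁ A ih =>
    have h : ∀ a : M, (fun i => (Formula.upSubst₁ σ i).realize (push₁ a ρ)) =
        push₁ a (fun i => (σ i).realize ρ) := by
      intro a
      funext i
      cases i with
      | zero => rfl
      | succ i => exact FirstOrder.Language.Term.realize_relabel
    funext w
    simp only [Formula.subst₁, realizers, ih, h]
  | all₂ κ n A ih =>
    funext w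
    simp only [Formula.subst₁, realizers, ih]

theorem realizers_rename₁ (A : Formula L) (r : ℕ → ℕ) (ρ : ℕ → M) (η : Env₂ W M) :
    realizers P (A.rename₁ r) ρ η = realizers P A (fun i => ρ (r i)) η :=
  realizers_subst₁ A _ ρ η

theorem realizers_inst₁ (A : Formula L) (a : L.Term ℕ) (ρ : ℕ → M) (η : Env₂ W M) :
    realizers P (A.inst₁ a) ρ η = realizers P A (push₁ (a.realize ρ) ρ) η := by
  rw [Formula.inst₁, realizers_subst₁]
  congr 1
  funext i
  cases i <;> rfl

theorem realizers_applyTo {n : ℕ} (G : Formula L) (ts : Fin n → L.Term ℕ) (ρ : ℕ → M)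
    (η : Env₂ W M) :
    realizers P (G.applyTo ts) ρ η =
      realizers P G (paramEnv (fun j => (ts j).realize ρ) ρ) η := by
  rw [Formula.applyTo, realizers_subst₁]
  congr 1
  funext j
  unfold paramEnv
  split_ifs <;> rfl

theorem realizers_rename₂ (A : Formula L) (r : Kind → ℕ → ℕ → ℕ) (ρ : ℕ → M) (η : Env₂ W M) :
    realizers P (A.rename₂ r) ρ η = realizers P A ρ (fun κ n i => η κ n (r κ n i)) := by
  induction A generalizing r ρ η with
  | bot => rfl
  | rel R ts => rfl
  | pvar κ n i ts => rfl
  | imp A B ihA ihB =>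
    funext w
    simp only [Formula.rename₂, realizers, ihA, ihB]
  | all₁ A ih =>
    funext w
    simp only [Formula.rename₂, realizers, ih]
  | all₂ κ n A ih =>
    have h : ∀ S : ∀ n : ℕ, (Fin n → M) → W → Set Tm,
        (fun κ' n' i => push₂ κ n S η κ' n' (Formula.upRen₂ κ n r κ' n' i)) =
          push₂ κ n S (fun κ' n' i => η κ' n' (r κ' n' i)) := by
      intro S
      funext κ' n' i
      unfold push₂ Formula.upRen₂
      split_ifs
      · cases i <;> rfl
      · rfl
    funext w
    simp only [Formula.rename₂, realizers, ih, h]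

theorem realizers_shift₂ (A : Formula L) (κ : Kind) (n : ℕ) (S : ∀ n : ℕ, (Fin n → M) → W → Set Tm)
    (ρ : ℕ → M) (η : Env₂ W M) :
    realizers P (A.shift₂ κ n) ρ (push₂ κ n S η) = realizers P A ρ η := by
  rw [Formula.shift₂, realizers_rename₂]
  congr 1
  funext κ' n' i
  unfold push₂
  split_ifs <;> rfl

theorem realizers_generic (κ : Kind) (n i : ℕ) (l : Fin n → M) (ρ : ℕ → M) (η : Env₂ W M) :
    realizers P (Formula.generic (L := L) κ n i) (paramEnv l ρ) η = η κ n i l := by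
  funext w
  simp [Formula.generic, realizers, paramEnv]

theorem realizers_subst₂ (A : Formula L) (σ : Kind → ℕ → ℕ → Formula L) (ρ : ℕ → M)
    (η : Env₂ W M) :
    realizers P (A.subst₂ σ) ρ η =
      realizers P A ρ (fun κ n i l => realizers P (σ κ n i) (paramEnv l ρ) η) := by
  induction A generalizing σ ρ η with
  | bot => rfl
  | rel R ts => rfl
  | pvar κ n i ts =>
    rw [Formula.subst₂, realizers_applyTo]
    rfl
  | imp A B ihA ihB =>
    funext w
    simp only [Formula.subst₂, realizers, ihA, ihB]
  | all₁ A ih =>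
    have h : ∀ a : M, (fun κ n i (l : Fin n → M) =>
        realizers P (Formula.upSubst₂₁ σ κ n i) (paramEnv l (push₁ a ρ)) η) =
          fun κ n i l => realizers P (σ κ n i) (paramEnv l ρ) η := by
      intro a
      funext κ n i l
      rw [Formula.upSubst₂₁, realizers_rename₁]
      congr 1
      funext j
      unfold paramEnv
      by_cases hj : j < n
      · simp [hj]
      · have h₁ : ¬ j + 1 < n := by omega
        have h₂ : j + 1 - n = j - n + 1 := by omega
        simp [hj, h₁, h₂, push₁]
    funext w
    simp only [Formula.subst₂, realizers, ih, h]
  | all₂ κ n A ih =>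
    have h : ∀ S : ∀ n : ℕ, (Fin n → M) → W → Set Tm,
        (fun κ' n' i (l : Fin n' → M) =>
          realizers P (Formula.upSubst₂₂ κ n σ κ' n' i) (paramEnv l ρ) (push₂ κ n S η)) =
          push₂ κ n S (fun κ' n' i l => realizers P (σ κ' n' i) (paramEnv l ρ) η) := by
      intro S
      funext κ' n' i l
      by_cases h : κ' = κ ∧ n' = n
      · obtain ⟨rfl, rfl⟩ := h
        cases i with
        | zero =>
          simp only [Formula.upSubst₂₂, and_self, if_true, realizers_generic, push₂]
        | succ i =>
          simp only [Formula.upSubst₂₂, and_self, if_true, realizers_shift₂]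
          simp only [push₂, and_self, if_true]
      · simp only [Formula.upSubst₂₂, h, if_false, realizers_shift₂]
        simp only [push₂, h, if_false]
    funext w
    simp only [Formula.subst₂, realizers, ih, h]

theorem realizers_inst₂ (κ : Kind) (n : ℕ) (A G : Formula L) (ρ : ℕ → M) (η : Env₂ W M) :
    realizers P (A.inst₂ κ n G) ρ η =
      realizers P A ρ (push₂ κ n (fun _ l => realizers P G (paramEnv l ρ) η) η) := by
  rw [Formula.inst₂, realizers_subst₂]
  congr 1
  funext κ' n' i l
  by_cases h : κ' = κ ∧ n' = n
  · obtain ⟨rfl, rfl⟩ := h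
    cases i with
    | zero => simp only [Formula.instSubst₂, push₂, and_self, if_true]
    | succ i => simp only [Formula.instSubst₂, push₂, and_self, if_true, realizers_generic]
  · simp only [Formula.instSubst₂, push₂, h, if_false, realizers_generic]

/-- The constant `C` realizes `¬¬A → A` when `A` is interpreted by a biorthogonal family. -/
theorem control_mem_realizers (hP : IsPole P) {A : Formula L} {ρ : ℕ → M} {η : Env₂ W M}
    (hcand : IsCandidate (realizers P A ρ η)) (hbi : IsBiorthogonal P (realizers P A ρ η)) (w : W) :
    Tm.C ∈ realizers P (.imp A.neg.neg A) ρ η w := by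
  intro w₁ _ t ht
  refine hbi w₁ _ fun w₂ h₂ π hπ => hP.control (ht w₂ h₂ _ ?_ w₂ le_rfl)
  intro w₃ h₃ s hs w₄ h₄
  refine hP.expand (.beta _ _ []) ?_
  rw [Tm.apps_shift_inst]
  exact hπ w₄ (h₃.trans h₄) s (hcand.mono h₄ hs)

/-- Adequacy: a typed term realizes its type, once its free variables are replaced by realizers of
their types. -/
theorem Typing.subst_mem_realizers (hP : IsPole P) {E : Set (L.Term ℕ × L.Term ℕ)}
    (hE : ∀ a b, TermEq E a b → ∀ ρ : ℕ → M, a.realize ρ = b.realize ρ)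
    {Γ : List (Formula L)} {t : Tm} {A : Formula L} (h : Typing E Γ t A) (ρ : ℕ → M)
    {η : Env₂ W M} (hη : IsEnv P η) (w : W) (γ : ℕ → Tm)
    (hγ : ∀ (i : ℕ) (B : Formula L), Γ[i]? = some B → γ i ∈ realizers P B ρ η w) :
    t.subst γ ∈ realizers P A ρ η w := by
  induction h generalizing ρ η w γ with
  | var h => exact hγ _ _ h
  | @lam Γ t A B _ ih =>
    intro w' h s hs
    refine (isCandidate_realizers hP B ρ hη).expand (.beta _ _ []) ?_
    rw [Tm.subst_upSubst_inst]
    refine ih ρ hη w' _ fun i D hD => ?_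
    cases i with
    | zero =>
      obtain rfl : A = D := by simpa using hD
      exact hs
    | succ i => exact (isCandidate_realizers hP D ρ hη).mono h (hγ i D (by simpa using hD))
  | app _ _ iht ihw => exact iht ρ hη w γ hγ w le_rfl _ (ihw ρ hη w γ hγ)
  | gen₁ _ ih =>
    intro a
    refine ih _ hη w γ fun i D hD => ?_
    rw [List.getElem?_map, Option.map_eq_some_iff] at hD
    obtain ⟨B, hB, rfl⟩ := hD
    rw [Formula.shift₁, realizers_rename₁]
    exact hγ i B hB
  | spec₁ a _ ih =>
    rw [realizers_inst₁]
    exact ih ρ hη w γ hγ _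
  | gen₂ κ n _ ih =>
    intro S hS
    refine ih ρ (hη.push₂ n hS) w γ fun i D hD => ?_
    rw [List.getElem?_map, Option.map_eq_some_iff] at hD
    obtain ⟨B, hB, rfl⟩ := hD
    rw [realizers_shift₂]
    exact hγ i B hB
  | spec₂ G _ ih =>
    rw [realizers_inst₂]
    exact ih ρ hη w γ hγ _ fun n' l => isValue_realizers hP (fun h => by cases h) _ hη
  | spec₂C G hG _ ih =>
    rw [realizers_inst₂]
    exact ih ρ hη w γ hγ _ fun n' l => isValue_realizers hP (fun _ => hG) _ hη
  | eqn hab _ ih =>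
    have := ih ρ hη w γ hγ
    rw [realizers_inst₁] at this ⊢
    rwa [← hE _ _ hab ρ]
  | control =>
    intro S hS
    exact control_mem_realizers hP (isCandidate_realizers hP _ ρ (hη.push₂ 0 hS))
      (isBiorthogonal_realizers hP (A := Formula.generic .classical 0 0) rfl ρ (hη.push₂ 0 hS)) w

theorem Typing.closedAt {E : Set (L.Term ℕ × L.Term ℕ)} {Γ : List (Formula L)} {t : Tm}
    {A : Formula L} (h : Typing E Γ t A) : t.ClosedAt Γ.length := by
  induction h with
  | var h => exact (List.getElem?_eq_some_iff.1 h).1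
  | lam _ ih => exact ih
  | app _ _ iht ihw => exact ⟨iht, ihw⟩
  | gen₁ _ ih => simpa using ih
  | gen₂ _ _ _ ih => simpa using ih
  | spec₁ _ _ ih => exact ih
  | spec₂ _ _ ih => exact ih
  | spec₂C _ _ _ ih => exact ih
  | eqn _ _ ih => exact ih
  | control => trivial

theorem isEnv_const_univ : IsEnv P (fun _ _ _ _ _ => Set.univ : Env₂ W M) :=
  fun _ _ _ _ => ⟨⟨fun _ _ => trivial, fun _ _ => trivial⟩, fun _ _ _ _ => trivial⟩

/-- Adequacy for closed terms in the empty context. -/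
theorem Typing.mem_realizers (hP : IsPole P) {E : Set (L.Term ℕ × L.Term ℕ)}
    (hE : ∀ a b, TermEq E a b → ∀ ρ : ℕ → M, a.realize ρ = b.realize ρ)
    {t : Tm} {A : Formula L} (h : Typing E [] t A) (ρ : ℕ → M) {η : Env₂ W M} (hη : IsEnv P η)
    (w : W) : t ∈ realizers P A ρ η w := by
  have := h.subst_mem_realizers hP hE ρ hη w Tm.var (by simp)
  rwa [Tm.subst_var] at this

end Realizability

open FirstOrder.Language (Term)
open FirstOrder.Language.Structure (funMap)

/-! ### The terms modulo the equations -/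

section TermModel

variable {L : FirstOrder.Language.{u, v}}

/-- The setoid of individual terms modulo the equations of `E`. -/
def termSetoid (E : Set (L.Term ℕ × L.Term ℕ)) : Setoid (L.Term ℕ) where
  r := TermEq E
  iseqv := ⟨.refl, .symm, .trans⟩

/-- The individual terms modulo the equations of `E`. -/
def TermModel (E : Set (L.Term ℕ × L.Term ℕ)) : Type u := Quotient (termSetoid E)

/-- The class of an individual term. -/
def TermModel.mk (E : Set (L.Term ℕ × L.Term ℕ)) (a : L.Term ℕ) : TermModel E :=
  Quotient.mk (termSetoid E) a

/-- The function symbols act on the classes of terms syntactically; the relation symbols, which are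
never used, are interpreted by the empty relation. -/
noncomputable instance (E : Set (L.Term ℕ × L.Term ℕ)) : L.Structure (TermModel E) where
  funMap g as := TermModel.mk E (.func g fun j => (as j).out)
  RelMap _ _ := False

theorem TermModel.mk_eq_mk {E : Set (L.Term ℕ × L.Term ℕ)} {a b : L.Term ℕ} :
    TermModel.mk E a = TermModel.mk E b ↔ TermEq E a b :=
  Quotient.eq (r := termSetoid E)

theorem TermModel.funMap_mk {E : Set (L.Term ℕ × L.Term ℕ)} {n : ℕ} (g : L.Functions n)
    (as : Fin n → L.Term ℕ) :
    funMap g (fun j => TermModel.mk E (as j)) = TermModel.mk E (.func g as) :=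
  TermModel.mk_eq_mk.2 (.congr g _ _ fun j => Quotient.mk_out (s := termSetoid E) (as j))

theorem TermModel.realize_mk {E : Set (L.Term ℕ × L.Term ℕ)} (a : L.Term ℕ) (σ : ℕ → L.Term ℕ) :
    a.realize (fun i => TermModel.mk E (σ i)) = TermModel.mk E (a.subst σ) := by
  induction a with
  | var i => rfl
  | func g as ih =>
    simp only [Term.realize, ih]
    exact TermModel.funMap_mk g _

theorem TermEq.realize_eq {E : Set (L.Term ℕ × L.Term ℕ)} {a b : L.Term ℕ} (h : TermEq E a b)
    (ρ : ℕ → TermModel E) : a.realize ρ = b.realize ρ := by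
  induction h with
  | ax a b h σ =>
    have key : ∀ ρ : ℕ → TermModel E, a.realize ρ = b.realize ρ := by
      intro ρ
      have hρ : ρ = fun i => TermModel.mk E (ρ i).out := by
        funext i
        exact (Quotient.out_eq (s := termSetoid E) (ρ i)).symm
      rw [hρ, TermModel.realize_mk, TermModel.realize_mk, TermModel.mk_eq_mk]
      exact .ax a b h _
    rw [Term.realize_subst, Term.realize_subst, key]
  | refl a => rfl
  | symm _ ih => exact ih.symm
  | trans _ _ ih₁ ih₂ => exact ih₁.trans ih₂
  | congr g as bs _ ih => simp only [Term.realize, ih]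

end TermModel

/-! ### Realizers of the types of integers -/

section Integers

variable {L : FirstOrder.Language.{u, v}} {M : Type*} [L.Structure M]

/-- The successor in a structure. -/
def succVal (succ : L.Functions 1) (m : M) : M := funMap succ fun _ => m

/-- The numerals of a structure. -/
def numVal (M : Type*) [L.Structure M] (zero : L.Functions 0) (succ : L.Functions 1) (k : ℕ) : M :=
  (succVal succ)^[k] (funMap zero fun j => j.elim0)

theorem numVal_succ (zero : L.Functions 0) (succ : L.Functions 1) (k : ℕ) :
    numVal M zero succ (k + 1) = succVal succ (numVal M zero succ k) :=
  Function.iterate_succ_apply' _ _ _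

theorem realize_zeroTerm (zero : L.Functions 0) (succ : L.Functions 1) (ρ : ℕ → M) :
    (zeroTerm zero).realize ρ = numVal M zero succ 0 := by
  simp only [zeroTerm, Term.realize, numVal, Function.iterate_zero, id]
  congr 1
  funext j
  exact j.elim0

theorem realize_numeral (zero : L.Functions 0) (succ : L.Functions 1) (k : ℕ) (ρ : ℕ → M) :
    (numeral zero succ k).realize ρ = numVal M zero succ k := by
  induction k with
  | zero => exact realize_zeroTerm zero succ ρ
  | succ k ih =>
    rw [numeral, Function.iterate_succ_apply', numVal_succ, ← ih]
    rfl

/-- Zero is not a successor and the successor is injective. -/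
def IsAdequateModel (M : Type*) [L.Structure M] (zero : L.Functions 0) (succ : L.Functions 1) :
    Prop :=
  (∀ m : M, succVal succ m ≠ numVal M zero succ 0) ∧ Function.Injective (succVal (M := M) succ)

theorem IsAdequateModel.numVal_injective {zero : L.Functions 0} {succ : L.Functions 1}
    (h : IsAdequateModel M zero succ) : Function.Injective (numVal M zero succ) := by
  intro j k hjk
  induction j generalizing k with
  | zero =>
    cases k with
    | zero => rfl
    | succ k => exact absurd (hjk.trans (numVal_succ zero succ k)).symm (h.1 _)
  | succ j ih =>
    cases k with
    | zero => exact absurd ((numVal_succ zero succ j).symm.trans hjk) (h.1 _)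
    | succ k =>
      rw [numVal_succ, numVal_succ] at hjk
      rw [ih (h.2 hjk)]

theorem Adequate.isAdequateModel {zero : L.Functions 0} {succ : L.Functions 1}
    {E : Set (L.Term ℕ × L.Term ℕ)} (hE : Adequate zero succ E) :
    IsAdequateModel (TermModel E) zero succ := by
  have hs : ∀ a, succVal succ (TermModel.mk E a) = TermModel.mk E (succTerm succ a) :=
    fun a => TermModel.funMap_mk succ fun _ => a
  have hz : numVal (TermModel E) zero succ 0 = TermModel.mk E (zeroTerm zero) := by
    rw [← realize_zeroTerm zero succ fun i => TermModel.mk E (.var i), TermModel.realize_mk]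
    congr 1
    simp only [zeroTerm, Term.subst]
    congr 1
    funext j
    exact j.elim0
  constructor
  · intro m
    induction m using Quotient.inductionOn with
    | h a =>
      change succVal succ (TermModel.mk E a) ≠ _
      rw [hs, hz, Ne, TermModel.mk_eq_mk]
      exact hE.1 a
  · intro m m' h
    induction m, m' using Quotient.inductionOn₂ with
    | h a b =>
      change succVal succ (TermModel.mk E a) = succVal succ (TermModel.mk E b) at h
      rw [hs, hs, TermModel.mk_eq_mk] at h
      exact TermModel.mk_eq_mk.2 (hE.2 a b h)

/-- The type of integers, with a second-order variable of kind `κ`: this is `natType` for the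
ordinary variables, and its translation `toC` for the classical ones. -/
def natTypeOf (κ : Kind) (zero : L.Functions 0) (succ : L.Functions 1) (a : L.Term ℕ) :
    Formula L :=
  .all₂ κ 1
    (.imp (.pvar κ 1 0 (fun _ => zeroTerm zero))
      (.imp
        (.all₁ (.imp (.pvar κ 1 0 (fun _ => .var 0))
          (.pvar κ 1 0 (fun _ => succTerm succ (.var 0)))))
        (.pvar κ 1 0 (fun _ => a))))

variable {W : Type*} [Preorder W] {P : W → Set Tm}

theorem app_app_mem_of_mem_natTypeOf {κ : Kind} {zero : L.Functions 0} {succ : L.Functions 1}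
    {a : L.Term ℕ} {ρ : ℕ → M} {η : Env₂ W M} {w : W} {t : Tm}
    (ht : t ∈ realizers P (natTypeOf κ zero succ a) ρ η w) {S : M → W → Set Tm}
    (hS : ∀ m, IsValue P κ (S m)) {r s : Tm} (hr : r ∈ S (numVal M zero succ 0) w)
    (hs : ∀ m w', w ≤ w' → ∀ p ∈ S m w', .app s p ∈ S (succVal succ m) w') :
    .app (.app t r) s ∈ S (a.realize ρ) w := by
  have h := ht (fun n l => if h : 0 < n then S (l ⟨0, h⟩) else fun _ => Set.univ) (by
    intro n l
    split_ifs
    · exact hS _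
    · exact isEnv_const_univ κ 0 0 (fun j => (j.elim0 : M)))
  simp only [realizers, push₂, and_self, if_true, Nat.lt_one_iff, dite_true,
    Set.mem_ofPred_eq] at h
  refine h w le_rfl r ?_ w le_rfl s ?_
  · rwa [realize_zeroTerm zero succ]
  · intro m w' hw' p hp
    exact hs m w' hw' p hp

theorem mem_natTypeOf_of_forall {κ : Kind} {zero : L.Functions 0} {succ : L.Functions 1}
    {a : L.Term ℕ} {ρ : ℕ → M} {η : Env₂ W M} {w : W} {t : Tm}
    (h : ∀ S : M → W → Set Tm, (∀ m, IsValue P κ (S m)) → ∀ w', w ≤ w' → ∀ r s,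
      r ∈ S (numVal M zero succ 0) w' →
      (∀ m w'', w' ≤ w'' → ∀ p ∈ S m w'', .app s p ∈ S (succVal succ m) w'') →
      .app (.app t r) s ∈ S (a.realize ρ) w') :
    t ∈ realizers P (natTypeOf κ zero succ a) ρ η w := by
  intro S hS
  simp only [realizers, push₂, and_self, if_true]
  intro w₁ h₁ r hr w₂ h₂ s hs
  refine h (fun m => S 1 fun _ => m) (fun m => hS 1 _) w₂ (h₁.trans h₂) r s ?_ ?_
  · rw [← realize_zeroTerm zero succ ρ]
    exact (hS 1 _).1.mono h₂ hr
  · intro m w' hw' p hp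
    exact hs m w' hw' p hp

/-- Whatever the pole, a realizer of `N[sⁿ(0)]` is beta-equivalent to the Church integer: the
variable `X` is ordinary, so that it may be interpreted by terms whose weak head reduction never
uses `C`. -/
theorem betaEq_church_of_mem_realizers {zero : L.Functions 0} {succ : L.Functions 1}
    (hM : IsAdequateModel M zero succ) {a : L.Term ℕ} {ρ : ℕ → M} {η : Env₂ W M} {w : W} {t : Tm}
    {n : ℕ} (ht : t ∈ realizers P (natType zero succ a) ρ η w)
    (ha : a.realize ρ = numVal M zero succ n) : Tm.BetaEq t (Tm.church n) := by
  obtain ⟨m, hm⟩ := t.exists_closedAt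
  let S : M → W → Set Tm := fun b _ =>
    {p | ∃ k, b = numVal M zero succ k ∧
      Tm.BetaEq p ((Tm.app (.var (m + 1)))^[k] (.var m)) ∧
      ∃ q, Relation.ReflTransGen Tm.WeakHeadStep p q ∧
        (q = .var m ∨ ∃ s, q = .app (.var (m + 1)) s)}
  have hS : ∀ b, IsValue P .ordinary (S b) := by
    refine fun b => ⟨⟨fun _ h => h, ?_⟩, fun h => by cases h⟩
    rintro _ p q hpq ⟨k, hk, heq, r, hr, hr'⟩
    exact ⟨k, hk, .trans _ _ _ (.rel _ _ hpq.betaStep) heq, r, .head hpq hr, hr'⟩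
  have h := app_app_mem_of_mem_natTypeOf (κ := .ordinary) ht hS (r := .var m) (s := .var (m + 1))
    ⟨0, rfl, .refl _, _, .refl, .inl rfl⟩ (by
      rintro b _ _ p ⟨k, rfl, heq, -⟩
      refine ⟨k + 1, (numVal_succ zero succ k).symm, ?_, _, .refl, .inr ⟨p, rfl⟩⟩
      rw [Function.iterate_succ_apply']
      exact heq.map fun _ _ h => h.appR _)
  obtain ⟨k, hk, heq, q, hq, hq'⟩ := h
  obtain rfl : n = k := hM.numVal_injective (ha.symm.trans hk)
  exact Tm.betaEq_church_of_fresh hm hq hq' heq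

end Integers

/-! ### The machine that runs a storage operator on an unknown integer -/

/-- The description of a variable standing for an unknown intermediate result: a numeral of value
`level` in the course of being computed by iterating `next` from `base`. -/
structure Datum where
  level : ℕ
  base : Tm
  next : Tm

/-- A state of the machine: a term, together with the descriptions of the unknowns introduced so
far. In the term, the variable `0` is the final continuation, the variable `1` is the unknown
integer, and the variable `j + 2` is described by the entry `j` of the list. -/
abbrev State := List Datum × Tm

/-- The transition of the machine when an unknown of a given level is called: at level `0` the
unknown is replaced by `base`, and at level `k + 1` by `(next)x` for a new unknown `x` of
level `k`. -/
def callState (Δ : List Datum) : ℕ → Tm → Tm → List Tm → State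
  | 0, r, _, π => (Δ, r.apps π)
  | k + 1, r, s, π => (Δ ++ [⟨k, r, s⟩], (Tm.app s (.var (Δ.length + 2))).apps π)

/-- One step of the machine: head C-reduction, extended by rules for the unknown integer, of
value `n`, and for the other unknowns. -/
def step (n : ℕ) (s : State) : Option State :=
  match s.2.head, s.2.args with
  | .lam r, t :: π => some (s.1, (r.inst t).apps π)
  | .C, t :: π => some (s.1, .app t (.lam (Tm.apps (.var 0) (π.map Tm.shift))))
  | .var 1, r :: t :: π => some (callState s.1 n r t π)
  | .var (j + 2), π => (s.1[j]?).map fun d => callState s.1 d.level d.base d.next π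
  | _, _ => none

/-- The state `s'` is reached from `s` in finitely many steps. -/
def Reach (n : ℕ) : State → State → Prop :=
  Relation.ReflTransGen fun s s' => step n s = some s'

/-- The run on an unknown integer has at most one result. -/
theorem Reach.final_unique {n : ℕ} {s s₁ s₂ : State} (h₁ : Reach n s s₁) (h₂ : Reach n s s₂)
    (hs₁ : step n s₁ = none) (hs₂ : step n s₂ = none) : s₁ = s₂ := by
  have key : ∀ {s s' : State}, Reach n s s' → step n s = none → s = s' := by
    intro s s' h hs
    rcases Relation.ReflTransGen.cases_head h with h | ⟨r, hr, -⟩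
    · exact h
    · rw [hs] at hr
      cases hr
  have hU : Relator.RightUnique fun s s' : State => step n s = some s' := by
    intro a b c hb hc
    exact Option.some.inj (hb.symm.trans hc)
  rcases Relation.ReflTransGen.total_of_right_unique hU h₁ h₂ with h | h
  · exact key h hs₁
  · exact (key h hs₂).symm

/-- The free variables of a state are among those that have been introduced. -/
def State.Scoped (s : State) : Prop :=
  s.2.ClosedAt (s.1.length + 2) ∧
    ∀ d ∈ s.1, d.base.ClosedAt (s.1.length + 2) ∧ d.next.ClosedAt (s.1.length + 2)

theorem scoped_callState {Δ : List Datum} {k : ℕ} {r t : Tm} {π : List Tm}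
    (hΔ : ∀ d ∈ Δ, d.base.ClosedAt (Δ.length + 2) ∧ d.next.ClosedAt (Δ.length + 2))
    (hr : r.ClosedAt (Δ.length + 2)) (ht : t.ClosedAt (Δ.length + 2))
    (hπ : ∀ p ∈ π, p.ClosedAt (Δ.length + 2)) : State.Scoped (callState Δ k r t π) := by
  cases k with
  | zero => exact ⟨Tm.closedAt_apps.2 ⟨hr, hπ⟩, hΔ⟩
  | succ k =>
    have hle : Δ.length + 2 ≤ (Δ ++ [(⟨k, r, t⟩ : Datum)]).length + 2 := by simp
    refine ⟨Tm.closedAt_apps.2 ⟨⟨ht.mono hle, ?_⟩, fun p hp => (hπ p hp).mono hle⟩, ?_⟩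
    · simp [Tm.ClosedAt, callState]
    · intro d hd
      rcases List.mem_append.1 hd with hd | hd
      · exact ⟨(hΔ d hd).1.mono hle, (hΔ d hd).2.mono hle⟩
      · obtain rfl := List.mem_singleton.1 hd
        exact ⟨hr.mono hle, ht.mono hle⟩

theorem scoped_of_step {n : ℕ} {s s' : State} (h : step n s = some s') (hs : s.Scoped) :
    s'.Scoped := by
  obtain ⟨Δ, p⟩ := s
  obtain ⟨hp, hΔ⟩ := hs
  dsimp only at hp hΔ
  rw [← Tm.head_apps_args p, Tm.closedAt_apps] at hp
  obtain ⟨hh, ha⟩ := hp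
  unfold step at h
  dsimp only at h
  split at h
  · next r t π e₁ e₂ =>
    cases h
    rw [e₁] at hh
    rw [e₂, List.forall_mem_cons] at ha
    exact ⟨Tm.closedAt_apps.2 ⟨Tm.ClosedAt.inst hh ha.1, ha.2⟩, hΔ⟩
  · next t π e₁ e₂ =>
    cases h
    rw [e₂, List.forall_mem_cons] at ha
    refine ⟨⟨ha.1, ?_⟩, hΔ⟩
    refine Tm.closedAt_apps.2 ⟨Nat.succ_pos _, fun q hq => ?_⟩
    obtain ⟨q', hq', rfl⟩ := List.mem_map.1 hq
    exact (ha.2 q' hq').shift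
  · next r t π e₁ e₂ =>
    cases h
    rw [e₂, List.forall_mem_cons, List.forall_mem_cons] at ha
    exact scoped_callState hΔ ha.1 ha.2.1 ha.2.2
  · next j e =>
    obtain ⟨d, hd, rfl⟩ := Option.map_eq_some_iff.1 h
    have := hΔ d (List.mem_of_getElem? hd)
    exact scoped_callState hΔ this.1 this.2 ha
  · cases h

theorem scoped_of_reach {n : ℕ} {s s' : State} (h : Reach n s s') (hs : s.Scoped) :
    s'.Scoped := by
  induction h with
  | refl => exact hs
  | tail _ h ih => exact scoped_of_step h ih

/-- The initial state: the term `T`, applied to the unknown integer and to the continuation. -/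
def startState (T : Tm) : State := ([], .app (.app T (.var 1)) (.var 0))

/-! ### Running the machine with a classical integer -/

/-- A world: the unknowns introduced so far, each with the term for which it stands when the unknown
integer is replaced by a given classical integer. -/
structure World where
  entries : List (Datum × Tm)

namespace World

/-- The worlds grow by introducing new unknowns. -/
instance : Preorder World where
  le Δ Δ' := Δ.entries <+: Δ'.entries
  le_refl _ := List.prefix_rfl
  le_trans _ _ _ := List.IsPrefix.trans

/-- The descriptions of the unknowns, as the machine knows them. -/
def data (Δ : World) : List Datum := Δ.entries.map Prod.fst

/-- The world with one more unknown. -/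
def extend (Δ : World) (d : Datum) (t : Tm) : World := ⟨Δ.entries ++ [(d, t)]⟩

/-- The substitution replacing the unknowns by the terms for which they stand: the continuation by
the variable `f`, and the unknown integer by `θ`. Variables that have not been introduced yet are
replaced by an arbitrary term. -/
def value (θ : Tm) (f : ℕ) (Δ : World) : ℕ → Tm
  | 0 => .var f
  | 1 => θ
  | j + 2 => (Δ.entries[j]?).elim .C Prod.snd

theorem le_extend (Δ : World) (d : Datum) (t : Tm) : Δ ≤ Δ.extend d t :=
  List.prefix_append _ _

@[simp] theorem length_data (Δ : World) : Δ.data.length = Δ.entries.length := List.length_map _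

theorem data_extend (Δ : World) (d : Datum) (t : Tm) : (Δ.extend d t).data = Δ.data ++ [d] := by
  simp [data, extend]

theorem getElem?_of_extend_le {Δ Δ' : World} {d : Datum} {t : Tm} (h : Δ.extend d t ≤ Δ') :
    Δ'.entries[Δ.data.length]? = some (d, t) := by
  obtain ⟨l, hl⟩ := h
  rw [← hl, extend, length_data, List.append_assoc, List.getElem?_append_right le_rfl]
  simp

theorem subst_value {θ : Tm} {f : ℕ} {Δ Δ' : World} (h : Δ ≤ Δ') {t : Tm}
    (ht : t.ClosedAt (Δ.data.length + 2)) : t.subst (Δ'.value θ f) = t.subst (Δ.value θ f) := by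
  refine ht.subst_congr fun i hi => ?_
  match i with
  | 0 => rfl
  | 1 => rfl
  | j + 2 =>
    obtain ⟨l, hl⟩ := h
    rw [length_data] at hi
    simp only [value, ← hl]
    rw [List.getElem?_append_left (by omega)]

end World

/-- The term `q` reduces to an instance of the result of the run of `T` on an unknown integer, and
this result is a Church integer up to beta-equivalence. -/
def Yields (T : Tm) (n f : ℕ) (q : Tm) : Prop :=
  ∃ τ Δ, Reach n (startState T) (Δ, .app (.var 0) τ) ∧ Tm.BetaEq τ (Tm.church n) ∧
    ∃ σ, Tm.HeadRed q (.app (.var f) (τ.subst σ))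

theorem Yields.of_headStep {T : Tm} {n f : ℕ} {p q : Tm} (h : Tm.HeadStep p q)
    (hq : Yields T n f q) : Yields T n f p := by
  obtain ⟨τ, Δ, h₁, h₂, σ, h₃⟩ := hq
  exact ⟨τ, Δ, h₁, h₂, σ, .head h h₃⟩

/-- The pole used for the classical integer. -/
def yieldPole (T : Tm) (n f : ℕ) (_ : Unit) : Set Tm := {q | Yields T n f q}

theorem isPole_yieldPole (T : Tm) (n f : ℕ) : IsPole (yieldPole T n f) :=
  ⟨fun h hq => .of_headStep h.headStep hq, fun hq => .of_headStep (.control _ _) hq⟩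

/-- The pole used for the storage operator. Only the terms that the machine actually meets are
constrained. -/
def runPole (T θ : Tm) (n f : ℕ) (Δ : World) : Set Tm :=
  {p | Reach n (startState T) (Δ.data, p) → Yields T n f (p.subst (Δ.value θ f))}

theorem isPole_runPole (T θ : Tm) (n f : ℕ) : IsPole (runPole T θ n f) := by
  constructor
  · intro Δ p q h hq hp
    refine .of_headStep (h.headStep.subst _) (hq (hp.tail ?_))
    cases h with
    | beta u t ts => simp [step, Tm.head, Tm.args]
  · intro Δ t π hq hp
    refine .of_headStep ((Tm.HeadStep.control t π).subst _) (hq (hp.tail ?_))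
    simp [step, Tm.head, Tm.args]

section Main

variable {L : FirstOrder.Language.{u, v}} {M : Type*} [L.Structure M] {zero : L.Functions 0}
  {succ : L.Functions 1} {T θ : Tm} {n f : ℕ}

/-- The stacks on which an unknown of level `k`, iterating `s` from `r`, is called by the machine
after the world `Δ₀`, as seen once the unknowns are replaced by their values. -/
def calledStacks (T θ : Tm) (n f : ℕ) (S : World → Set Tm) (Δ₀ : World) (k : ℕ) (r s : Tm) :
    Set (List Tm) :=
  {c | ∃ Δ, Δ₀ ≤ Δ ∧ ∃ π ∈ orth (runPole T θ n f) S Δ, (∀ p ∈ π, p.ClosedAt (Δ.data.length + 2)) ∧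
    Reach n (startState T) (callState Δ.data k r s π) ∧ c = π.map (Tm.subst (Δ.value θ f))}

/-- The unknown integer realizes `N^C[sⁿ(0)]`. When the machine calls it on `r`, `s` and a stack,
the classical integer `θ` is applied to the values of these terms. The values of `X_C` for `θ` are then
the orthogonals of the sets of stacks on which the intermediate unknowns are called. -/
theorem unknown_mem_realizers (hM : IsAdequateModel M zero succ) (hT : T.Closed) {a b : L.Term ℕ}
    {ρ ρ' : ℕ → M} (ha : a.realize ρ = numVal M zero succ n)
    (hb : b.realize ρ' = numVal M zero succ n) {η : Env₂ World M} {η' : Env₂ Unit M}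
    (hθ : θ ∈ realizers (yieldPole T n f) (natTypeOf .classical zero succ b) ρ' η' ()) (Δ : World) :
    .var 1 ∈ realizers (runPole T θ n f) (natTypeOf .classical zero succ a) ρ η Δ := by
  have hstart : (startState T).Scoped := by
    refine ⟨⟨⟨hT.mono (Nat.zero_le _), ?_⟩, ?_⟩, fun d hd => ?_⟩
    · simp [Tm.ClosedAt]
    · simp [Tm.ClosedAt]
    · exact absurd hd List.not_mem_nil
  refine mem_natTypeOf_of_forall fun S hS Δ₁ _ r s hr hs => ?_
  rw [ha]
  refine (hS _).2 rfl _ _ fun Δ₀ h₀ π hπ hreach => ?_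
  have hreach₁ : Reach n (startState T) (callState Δ₀.data n r s π) := by
    refine hreach.tail ?_
    simp [step, Tm.head, Tm.args]
  -- The terms `r` and `s` have no other unknowns than those of `Δ₀`, so that their values do not
  -- change in later worlds.
  obtain ⟨hcl, -⟩ := scoped_of_reach hreach hstart
  obtain ⟨⟨⟨-, hcr⟩, hcs⟩, hcπ⟩ := Tm.closedAt_apps.1 hcl
  dsimp only at hcr hcs hcπ
  let V := Tm.subst (Δ₀.value θ f)
  let S' : M → Unit → Set Tm := fun m _ =>
    {t | ∀ k, m = numVal M zero succ k →
      ∀ c ∈ calledStacks T θ n f (S m) Δ₀ k r s, Yields T n f (t.apps c)}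
  have hS' : ∀ m, IsValue (yieldPole T n f) .classical (S' m) := by
    refine fun m => ⟨⟨fun _ h => h, fun h hq k hk c hc => ?_⟩, fun _ _ t ht k hk c hc => ?_⟩
    · exact .of_headStep (h.apps c).headStep (hq k hk c hc)
    · exact ht () le_rfl c fun _ _ p hp => hp k hk c hc
  have key := app_app_mem_of_mem_natTypeOf hθ hS' (r := V r) (s := V s) ?_ ?_
  · rw [hb] at key
    have := key n rfl _ ⟨Δ₀, le_rfl, π, hπ, hcπ, hreach₁, rfl⟩
    rwa [Tm.subst_apps]
  · -- The value of `r` at level `0`.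
    rintro k hk _ ⟨Δ₂, h₂, π₂, hπ₂, -, hreach₂, rfl⟩
    obtain rfl := hM.numVal_injective hk
    have := hπ₂ Δ₂ le_rfl r ((hS _).1.mono (h₀.trans h₂) hr) hreach₂
    rwa [Tm.subst_apps, World.subst_value h₂ hcr] at this
  · -- The value of `s` from level `j` to level `j + 1`: the machine introduces a new unknown, whose
    -- value is `t`.
    rintro m _ _ t ht k hk _ ⟨Δ₂, h₂, π₂, hπ₂, hcπ₂, hreach₂, rfl⟩
    obtain _ | j := k
    · exact absurd hk (hM.1 m)
    rw [numVal_succ] at hk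
    obtain rfl := hM.2 hk
    let Δ₃ := Δ₂.extend ⟨j, r, s⟩ t
    have h₃ : Δ₂ ≤ Δ₃ := Δ₂.le_extend _ _
    have hx : .var (Δ₂.data.length + 2) ∈ S (numVal M zero succ j) Δ₃ := by
      refine (hS _).2 rfl _ _ fun Δ₄ h₄ π₄ hπ₄ hreach₄ => ?_
      have hget := World.getElem?_of_extend_le h₄
      have hget' : Δ₄.data[Δ₂.data.length]? = some ⟨j, r, s⟩ := by
        rw [World.data, List.getElem?_map, hget]
        rfl
      have hcl₄ := Tm.closedAt_apps.1 (scoped_of_reach hreach₄ hstart).1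
      have hval : (Tm.var (Δ₂.data.length + 2)).subst (Δ₄.value θ f) = t := by
        simp only [Tm.subst, World.value, hget, Option.elim]
      rw [Tm.subst_apps, hval]
      refine ht j rfl _ ⟨Δ₄, h₂.trans (h₃.trans h₄), π₄, hπ₄, hcl₄.2, hreach₄.tail ?_, rfl⟩
      simp only [step, Tm.head_apps, Tm.head, Tm.args_apps, Tm.args, hget', Option.map_some,
        List.nil_append]
    have hmem := hs _ Δ₃ (h₀.trans (h₂.trans h₃)) _ hx
    have := hπ₂ Δ₃ h₃ _ hmem (by rw [World.data_extend]; exact hreach₂)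
    rw [Tm.subst_apps] at this
    have hget := World.getElem?_of_extend_le (le_refl Δ₃)
    have hval : (Tm.app s (.var (Δ₂.data.length + 2))).subst (Δ₃.value θ f) = .app (V s) t := by
      simp only [Tm.subst, World.value, hget, Option.elim,
        World.subst_value (h₂.trans h₃) hcs, V]
    have hargs : π₂.map (Tm.subst (Δ₃.value θ f)) = π₂.map (Tm.subst (Δ₂.value θ f)) :=
      List.map_congr_left fun p hp => World.subst_value h₃ (hcπ₂ p hp)
    rwa [hval, hargs] at this

/-- The run of `T` on an unknown integer of value `n` ends with a result which is a Church integer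
up to beta-equivalence, and `(T)θ f` reduces to `(f)` applied to an instance of it. -/
theorem yields_of_isClassicalInteger {E : Set (L.Term ℕ × L.Term ℕ)} (hE : Adequate zero succ E)
    (hT : Typing E [] T (storageType zero succ)) (hθ : IsClassicalInteger zero succ E n θ) (f : ℕ) :
    Yields T n f (.app (.app T θ) (.var f)) := by
  have hM := hE.isAdequateModel
  have hTc : T.Closed := hT.closedAt
  let P := runPole T θ n f
  let Δ₀ : World := ⟨[]⟩
  let c := numVal (TermModel E) zero succ n
  have hθ' := hθ.2.mem_realizers (isPole_yieldPole T n f) (fun a b h ρ => h.realize_eq ρ)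
    (fun _ => c) isEnv_const_univ ()
  have hT' := hT.mem_realizers (isPole_runPole T θ n f) (fun a b h ρ => h.realize_eq ρ)
    (fun _ => c) isEnv_const_univ Δ₀ c
  have hν := unknown_mem_realizers (a := .var 0) (ρ := push₁ c fun _ => c) hM hTc rfl
    (realize_numeral zero succ n _) (η := fun _ _ _ _ _ => Set.univ) hθ' Δ₀
  have hf : .var 0 ∈ realizers P (natType zero succ (.var 0)).neg (push₁ c fun _ => c)
      (fun _ _ _ _ _ => Set.univ) Δ₀ := by
    intro Δ₁ _ τ hτ Δ₂ _ hreach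
    exact ⟨τ, _, hreach, betaEq_church_of_mem_realizers hM hτ rfl, Δ₂.value θ f, .refl⟩
  have := hT' Δ₀ le_rfl _ hν Δ₀ le_rfl _ hf Δ₀ le_rfl .refl
  simpa [Tm.subst, World.value, hTc.subst_eq] using this

end Main

end MixedLogic

theorem theorem8p5 (L : FirstOrder.Language.{u, v}) (zero : L.Functions 0) (succ : L.Functions 1)
    (E : Set (L.Term ℕ × L.Term ℕ)) (hE : MixedLogic.Adequate zero succ E) (T : MixedLogic.Tm)
    (hT : MixedLogic.Typing E [] T (MixedLogic.storageType zero succ)) :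
    MixedLogic.IsStorageOperator zero succ E T := by
  refine ⟨hT.closedAt, fun n => ?_⟩
  by_cases h : ∃ τ Δ, MixedLogic.Reach n (MixedLogic.startState T) (Δ, .app (.var 0) τ) ∧
      MixedLogic.Tm.BetaEq τ (MixedLogic.Tm.church n)
  · obtain ⟨τ, Δ, hreach, hτ⟩ := h
    refine ⟨τ, hτ, fun θ hθ f => ?_⟩
    obtain ⟨τ', Δ', hreach', -, σ, hσ⟩ := MixedLogic.yields_of_isClassicalInteger hE hT hθ f
    -- The run ends in at most one state, so that its result does not depend on `θ`.
    have := hreach.final_unique hreach' (by simp [MixedLogic.step, MixedLogic.Tm.head])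
      (by simp [MixedLogic.step, MixedLogic.Tm.head])
    simp only [Prod.mk.injEq, MixedLogic.Tm.app.injEq, true_and] at this
    exact ⟨σ, this.2 ▸ hσ⟩
  · -- There is no classical integer of value `n` in this case.
    refine ⟨_, .refl _, fun θ hθ f => ?_⟩
    obtain ⟨τ, Δ, hreach, hτ, -⟩ := MixedLogic.yields_of_isClassicalInteger hE hT hθ f
    exact absurd ⟨τ, Δ, hreach, hτ⟩ h
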